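/- Let $k\ge 2$ be an integer, let $\varepsilon>0$, let $\beta\ge\frac{2k-1}{k-1}+\varepsilon$, and let $c_1,c_2$ be constants with $c_1>0$. For positive weights $w=(w_1,\dots,w_n)$ write $w_{\min}=\min_i w_i$, $w_{\max}=\max_i w_i$ and $F(x)=\frac1n\,|\{i : w_i\ge x\}|$. Say that $w$ follows a power law with exponent $\beta$ and constants $c_1,c_2$ if $$c_1\le w_{\min}\le c_2,\qquad c_1 n^{1/(\beta-1)}\le w_{\max}\le c_2 n^{1/(\beta-1)},$$ $$c_1x^{1-\beta}\le F(x)\le c_2x^{1-\beta}\quad\text{for all }x\in[w_{\min},w_{\max}].$$ A random $k$-SAT formula on $n$ variables $x_1,\dots,x_n$ with weights $w$ and $m$ clauses is a conjunction of $m$ independent random clauses. Each of them is generated as follows: select $k$ variables independently, each being $x_i$ with probability $p_i=w_i/\sum_j w_j$, and repeat until the $k$ variables are pairwise distinct; then negate each of them independently with probability $\frac12$; the clause is the disjunction of the $k$ resulting literals. Then there are constants $r_0>0$, $\delta>0$ and $C$, depending only on $k,\varepsilon,\beta,c_1,c_2$, such that for all $n\ge k$, all weights $w=(w_1,\dots,w_n)$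 that follow a power law with exponent $\beta$ and constants $c_1,c_2$, and all $m$ with $m/n\le r_0$, the random $k$-SAT formula on $n$ variables with weights $w$ and $m$ clauses is satisfiable with probability at least $1-Cn^{-\delta}$. In other words: power-law random $k$-SAT with exponent $\beta\ge\frac{2k-1}{k-1}+\varepsilon$ is satisfiable with high probability if the clause–variable ratio $m/n$ is at most a small enough constant. -/

import Mathlib

open MeasureTheory ProbabilityTheory

noncomputable section

/-- The tail `F(x) = Pr[W ≥ x]` of a weight `W` chosen uniformly at random among `w_1, …, w_n`. -/
def weightTail {n : ℕ} (w : Fin n → ℝ) (x : ℝ) : ℝ :=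
  (Nat.card {i : Fin n // x ≤ w i} : ℝ) / n

/-- The weights `w_1, …, w_n` follow a (general) power law with exponent `β`, where `c₁` and `c₂`
are the constants behind the `Θ`s: the smallest weight is `Θ(1)`, the largest weight is
`Θ(n ^ (1 / (β - 1)))`, and `F(x) = Θ(x ^ (1 - β))` for all `x` between these two. The weights
need not be sorted. -/
structure FollowsPowerLaw {n : ℕ} (w : Fin n → ℝ) (β c₁ c₂ : ℝ) : Prop where
  min_lower : c₁ ≤ ⨅ i, w i
  min_upper : ⨅ i, w i ≤ c₂
  max_lower : c₁ * (n : ℝ) ^ (1 / (β - 1)) ≤ ⨆ i, w i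
  max_upper : ⨆ i, w i ≤ c₂ * (n : ℝ) ^ (1 / (β - 1))
  tail_lower : ∀ x ∈ Set.Icc (⨅ i, w i) (⨆ i, w i), c₁ * x ^ (1 - β) ≤ weightTail w x
  tail_upper : ∀ x ∈ Set.Icc (⨅ i, w i) (⨆ i, w i), weightTail w x ≤ c₂ * x ^ (1 - β)

/-- The distribution on the variables with `p_i = w_i / ∑ j, w_j`. -/
def varDist {n : ℕ} (w : Fin n → ℝ) : Measure (Fin n) :=
  ∑ i, ENNReal.ofReal (w i / ∑ j, w j) • Measure.dirac i

/-- A clause of length `k` over `n` variables: the variables of its `k` literals, and for each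
literal the truth value of its variable that makes the literal true (`false`: negated). -/
abbrev Clause (k n : ℕ) : Type := (Fin k → Fin n) × (Fin k → Bool)

/-- A formula in conjunctive normal form with `m` clauses of length `k` over `n` variables. -/
abbrev Formula (k n m : ℕ) : Type := Fin m → Clause k n

/-- An assignment satisfies a clause if it makes at least one literal true. -/
def Clause.SatisfiedBy {k n : ℕ} (c : Clause k n) (σ : Fin n → Bool) : Prop :=
  ∃ j, σ (c.1 j) = c.2 j

def Formula.Satisfiable {k n m : ℕ} (Φ : Formula k n m) : Prop :=
  ∃ σ : Fin n → Bool, ∀ a, Clause.SatisfiedBy (Φ a) σ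

/-- The variables of a random clause: `k` independent samples from `varDist w`, repeated until no
two coincide, that is, conditioned on being pairwise distinct. -/
def randomVars (k : ℕ) {n : ℕ} (w : Fin n → ℝ) : Measure (Fin k → Fin n) :=
  (Measure.pi fun _ : Fin k => varDist w)[|{v | Function.Injective v}]

/-- A random clause: random distinct variables, each negated independently with probability
one half. -/
def randomClause (k : ℕ) {n : ℕ} (w : Fin n → ℝ) : Measure (Clause k n) :=
  (randomVars k w).prod (Measure.pi fun _ : Fin k => (PMF.uniformOfFintype Bool).toMeasure)

/-- Random `k`-SAT with variable weights `w`: `m` independent random clauses. -/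
def randomFormula (k m : ℕ) {n : ℕ} (w : Fin n → ℝ) : Measure (Formula k n m) :=
  Measure.pi fun _ : Fin m => randomClause k w

end

open MeasureTheory ProbabilityTheory

/-! Shrink every clause to its two lightest variables and view these as an edge of a multigraph on
the variables. If the edges have distinct representatives among their endpoints, each clause owns a
variable and can be satisfied through it (`Formula.satisfiable_of_injective`). Otherwise Hall's
theorem yields a connected piece with more edges than vertices, hence a bicycle
(`exists_injective_or_bicycle`).

Bicycles are excluded by a first-moment bound. With `M = max (w i) (w j)`, a clause has lightest
pair `i, j` with probability of order `w i * w j / n ^ 2 * (M ^ (2 - β)) ^ (k - 2)`, which is at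
most `K / n ^ 2 * q i * q j` for `q i = w i ^ (a / 2)` (`exists_lightestPair_bound`). An interior
vertex of the walk contributes `q i ^ 2`, and `∑ q i ^ 2 = ∑ w i ^ a` is linear in `n` when `a < β -
1` (`exists_sum_rpow_le`); the admissible `a` exist exactly when `β > (2k-1)/(k-1)`. For small `m /
n` the expected counts then decay geometrically in the length, and the two ends of the walk leave a
factor `n ^ (-δ)` (`measureReal_exists_bicycle_le`). -/

/-! ### Bicycles in multigraphs without distinct representatives. -/

/-- Every vertex `v` owns an edge `g v` leading to `f v`, and `e` is one edge too many. Iterating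
`f` from either end of `e` must eventually revisit a vertex; the two orbits joined by `e` form the
bicycle. -/
theorem exists_bicycle_of_functional {ι V : Type*} [Finite V] (Adj : ι → V → V → Prop)
    (hsymm : ∀ c i j, Adj c i j → Adj c j i) (f : V → V) (g : V → ι)
    (hg : Function.Injective g) (hfg : ∀ v, Adj (g v) v (f v)) (e : ι) (he : ∀ v, g v ≠ e)
    (a b : V) (hab : Adj e a b) :
    ∃ (t : ℕ) (u : ℕ → V) (c : ℕ → ι),
      (∀ l < t + 2, ∀ l' < t + 2, c l = c l' → l = l') ∧
      (∀ l < t + 2, Adj (c l) (u l) (u (l + 1))) ∧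
      (∃ i ≤ t, u 0 = u (i + 1)) ∧ ∃ j ≤ t, u (t + 2) = u (j + 1) := by
  classical
  have hrep : ∀ z : V, ∃ p, ∃ i < p, f^[p] z = f^[i] z := by
    intro z
    obtain ⟨i, j, hij, h⟩ := Finite.exists_ne_map_eq_of_infinite fun l : ℕ => f^[l] z
    rcases lt_or_gt_of_ne hij with hlt | hlt
    · exact ⟨j, i, hlt, h.symm⟩
    · exact ⟨i, j, hlt, h⟩
  have hp : ∃ p, ∃ i ≤ p, f^[p + 1] a = f^[i] a := by
    obtain ⟨p, i, hi, h⟩ := hrep a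
    obtain ⟨p, rfl⟩ : ∃ p', p = p' + 1 := ⟨p - 1, by omega⟩
    exact ⟨p, i, by omega, h⟩
  obtain ⟨p, ⟨i₀, hi₀, hpi⟩, hpmin⟩ : ∃ p, (∃ i ≤ p, f^[p + 1] a = f^[i] a) ∧
      ∀ p' < p, ¬ ∃ i ≤ p', f^[p' + 1] a = f^[i] a :=
    ⟨Nat.find hp, Nat.find_spec hp, fun _ h => Nat.find_min hp h⟩
  -- The second orbit stops as soon as it meets the first one or itself; `q = 0` occurs when `b`
  -- already lies on the orbit of `a`.
  have hq : ∃ q, (∃ i ≤ p, f^[q] b = f^[i] a) ∨ ∃ i < q, f^[q] b = f^[i] b := by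
    obtain ⟨q, hq⟩ := hrep b
    exact ⟨q, Or.inr hq⟩
  obtain ⟨q, hqi, hqmin⟩ : ∃ q, ((∃ i ≤ p, f^[q] b = f^[i] a) ∨ ∃ i < q, f^[q] b = f^[i] b) ∧
      ∀ q' < q, ¬ ((∃ i ≤ p, f^[q'] b = f^[i] a) ∨ ∃ i < q', f^[q'] b = f^[i] b) :=
    ⟨Nat.find hq, Nat.find_spec hq, fun _ h => Nat.find_min hq h⟩
  have hA : ∀ i j, i < j → j ≤ p → f^[j] a ≠ f^[i] a := by
    intro i j hij hj h
    obtain ⟨j, rfl⟩ : ∃ j', j = j' + 1 := ⟨j - 1, by omega⟩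
    exact hpmin j (by omega) ⟨i, by omega, h⟩
  have hA' : ∀ i ≤ p, ∀ j ≤ p, f^[i] a = f^[j] a → i = j := by
    intro i hi j hj h
    rcases lt_trichotomy i j with hlt | heq | hlt
    · exact absurd h.symm (hA i j hlt hj)
    · exact heq
    · exact absurd h (hA j i hlt hi)
  have hB' : ∀ i < q, ∀ j < q, f^[i] b = f^[j] b → i = j := by
    intro i hi j hj h
    rcases lt_trichotomy i j with hlt | heq | hlt
    · exact absurd (Or.inr ⟨i, hlt, h.symm⟩) (hqmin j hj)
    · exact heq
    · exact absurd (Or.inr ⟨j, hlt, h⟩) (hqmin i hi)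
  have hAB : ∀ i < q, ∀ j ≤ p, f^[i] b ≠ f^[j] a := fun i hi j hj h =>
    hqmin i hi (Or.inl ⟨j, hj, h⟩)
  -- The walk runs backwards along the orbit from `f^[p + 1] a` to `a`, crosses `e`, and goes on
  -- from `b` to `f^[q] b`. Minimality of `p` and `q` makes the owners of its edges, hence the
  -- edges, distinct.
  refine ⟨p + q, fun l => if l ≤ p + 1 then f^[p + 1 - l] a else f^[l - (p + 2)] b,
    fun l => if l ≤ p then g (f^[p - l] a) else if l = p + 1 then e else g (f^[l - (p + 2)] b),
    ?_, ?_, ?_, ?_⟩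
  · intro l hl l' hl' h
    simp only at h
    split_ifs at h with h1 h2 h3 h4 h5 h6 h7 h8
    · have := hA' _ (by omega) _ (by omega) (hg h)
      omega
    · exact absurd h (he _)
    · exact absurd (hg h).symm (hAB _ (by omega) _ (by omega))
    · exact absurd h.symm (he _)
    · omega
    · exact absurd h.symm (he _)
    · exact absurd (hg h) (hAB _ (by omega) _ (by omega))
    · exact absurd h (he _)
    · have := hB' _ (by omega) _ (by omega) (hg h)
      omega
  · intro l hl
    simp only
    rcases lt_trichotomy l (p + 1) with h1 | rfl | h1
    · rw [if_pos (by omega), if_pos (by omega), if_pos (by omega),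
        show p + 1 - l = (p - l) + 1 by omega, show p + 1 - (l + 1) = p - l by omega,
        Function.iterate_succ_apply']
      exact hsymm _ _ _ (hfg _)
    · simpa using hab
    · rw [if_neg (by omega), if_neg (by omega), if_neg (by omega), if_neg (by omega),
        show l + 1 - (p + 2) = (l - (p + 2)) + 1 by omega, Function.iterate_succ_apply']
      exact hfg _
  · refine ⟨p - i₀, by omega, ?_⟩
    simp only
    rw [if_pos (by omega), if_pos (by omega), show p + 1 - (p - i₀ + 1) = i₀ by omega]
    exact hpi
  · rcases hqi with ⟨i, hi, h⟩ | ⟨i, hi, h⟩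
    · refine ⟨p - i, by omega, ?_⟩
      simp only
      rw [if_neg (by omega), if_pos (by omega), show p + 1 - (p - i + 1) = i by omega,
        show p + q + 2 - (p + 2) = q by omega]
      exact h
    · refine ⟨p + 1 + i, by omega, ?_⟩
      simp only
      rw [if_neg (by omega), if_neg (by omega), show p + 1 + i + 1 - (p + 2) = i by omega,
        show p + q + 2 - (p + 2) = q by omega]
      exact h

/-- A walk with pairwise distinct edges whose two ends also occur among its interior vertices,
which are `v 0, …, v t`. -/
def HasBicycle {ι V : Type*} (Adj : ι → V → V → Prop) (t : ℕ) (v : Fin (t + 1) → V)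
    (i j : Fin (t + 1)) (c : Fin (t + 2) → ι) : Prop :=
  Function.Injective c ∧ ∀ l : Fin (t + 2),
    Adj (c l) ((Fin.cons (v i) (Fin.snoc v (v j) : Fin (t + 2) → V) : Fin (t + 3) → V) l.castSucc)
      ((Fin.cons (v i) (Fin.snoc v (v j) : Fin (t + 2) → V) : Fin (t + 3) → V) l.succ)

theorem HasBicycle.of_walk {ι V : Type*} {Adj : ι → V → V → Prop} {t : ℕ} {u : ℕ → V}
    {c : ℕ → ι} (hc : ∀ l < t + 2, ∀ l' < t + 2, c l = c l' → l = l')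
    (hadj : ∀ l < t + 2, Adj (c l) (u l) (u (l + 1)))
    (i j : Fin (t + 1)) (hi : u 0 = u (i + 1)) (hj : u (t + 2) = u (j + 1)) :
    HasBicycle Adj t (fun l => u (l + 1)) i j (fun l => c l) := by
  have key : (Fin.cons (u (i + 1)) (Fin.snoc (fun l : Fin (t + 1) => u (l + 1)) (u (j + 1)) :
      Fin (t + 2) → V) : Fin (t + 3) → V) = fun l : Fin (t + 3) => u l := by
    funext l
    refine Fin.cases ?_ (fun l => ?_) l
    · simpa using hi.symm
    · refine Fin.lastCases ?_ (fun l => ?_) l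
      · simpa using hj.symm
      · simp
  refine ⟨fun l l' h => Fin.ext (hc _ l.2 _ l'.2 h), fun l => ?_⟩
  rw [key]
  simpa using hadj l l.2

/-- If the edges `{x c, y c}` of a multigraph cannot be assigned to pairwise distinct endpoints,
then the multigraph contains a bicycle. -/
theorem exists_injective_or_bicycle {ι V : Type*} [Finite ι] (x y : ι → V) :
    (∃ φ : ι → V, Function.Injective φ ∧ ∀ c, φ c = x c ∨ φ c = y c) ∨
    ∃ t v i j c, HasBicycle (fun c i j => (x c = i ∧ y c = j) ∨ (x c = j ∧ y c = i)) t v i j c := by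
  classical
  have := Fintype.ofFinite ι
  by_cases hall : ∀ s : Finset ι, s.card ≤ (s.biUnion fun c => {x c, y c}).card
  · left
    obtain ⟨φ, hφ, h⟩ := (Finset.all_card_le_biUnion_card_iff_exists_injective _).1 hall
    exact ⟨φ, hφ, fun c => by simpa using h c⟩
  right
  push Not at hall
  -- A smallest violator of Hall's condition: after deletion of one edge `e` the condition holds,
  -- since any violator left would be smaller than `s`.
  obtain ⟨s, hs, hmin⟩ := Finset.exists_min_image
    (Finset.univ.filter fun s : Finset ι => (s.biUnion fun c => {x c, y c}).card < s.card)
    Finset.card (by obtain ⟨s, hs⟩ := hall; exact ⟨s, by simpa using hs⟩)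
  simp only [Finset.mem_filter, Finset.mem_univ, true_and] at hs hmin
  obtain ⟨e, he⟩ : s.Nonempty := by
    rw [← Finset.card_pos]; omega
  obtain ⟨φ, hφ, hφmem⟩ := (Finset.all_card_le_biUnion_card_iff_exists_injective
      fun c : {c // c ∈ s.erase e} => ({x c, y c} : Finset V)).1 (by
    intro r
    by_contra! hr
    have h1 := hmin (r.map (Function.Embedding.subtype _)) (by
      rw [Finset.card_map]
      rw [Finset.map_eq_image, Finset.image_biUnion]
      exact hr)
    rw [Finset.card_map] at h1
    have h2 : r.card ≤ (s.erase e).card := by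
      simpa only [Fintype.card_coe] using Finset.card_le_univ r
    rw [Finset.card_erase_of_mem he] at h2
    have := Finset.card_pos.2 ⟨e, he⟩
    omega)
  set W := s.biUnion fun c => ({x c, y c} : Finset V) with hW
  have hxW : ∀ c ∈ s, x c ∈ W := fun c hc => Finset.mem_biUnion.2 ⟨c, hc, by simp⟩
  have hyW : ∀ c ∈ s, y c ∈ W := fun c hc => Finset.mem_biUnion.2 ⟨c, hc, by simp⟩
  -- `W` has at most `s.card - 1` elements, so the matching of `s.erase e` exhausts it and can be
  -- inverted to give every vertex its own edge.
  have himg : Finset.univ.image φ = W := by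
    apply Finset.eq_of_subset_of_card_le
    · intro v hv
      obtain ⟨c, -, rfl⟩ := Finset.mem_image.1 hv
      exact Finset.mem_biUnion.2 ⟨c, Finset.mem_of_mem_erase c.2, hφmem c⟩
    · rw [Finset.card_image_of_injective _ hφ, Finset.card_univ, Fintype.card_coe,
        Finset.card_erase_of_mem he]
      omega
  have hex : ∀ v : W, ∃ c, φ c = v := fun v => by
    obtain ⟨c, -, hc⟩ := Finset.mem_image.1 (himg.ge v.2)
    exact ⟨c, hc⟩
  choose g hg using hex
  have hends : ∀ v : W, ∃ z : W, (x (g v) = v ∧ y (g v) = z) ∨ (x (g v) = z ∧ y (g v) = v) := by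
    intro v
    have h1 := hφmem (g v)
    have h2 : (g v : ι) ∈ s := Finset.mem_of_mem_erase (g v).2
    rw [hg] at h1
    simp only [Finset.mem_insert, Finset.mem_singleton] at h1
    rcases h1 with h1 | h1
    · exact ⟨⟨_, hyW _ h2⟩, Or.inl ⟨h1.symm, rfl⟩⟩
    · exact ⟨⟨_, hxW _ h2⟩, Or.inr ⟨rfl, h1.symm⟩⟩
  choose f hf using hends
  obtain ⟨t, u, c, hc, hadj, ⟨i, hi, hui⟩, j, hj, huj⟩ := exists_bicycle_of_functional
    (fun c (i j : W) => (x c = i ∧ y c = j) ∨ (x c = j ∧ y c = i))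
    (fun c i j h => h.symm) f (fun v => (g v : ι))
    (fun v v' h => by
      have := congrArg φ (Subtype.ext h)
      rw [hg, hg] at this
      exact Subtype.ext this)
    hf e (fun v => Finset.ne_of_mem_erase (g v).2) ⟨x e, hxW e he⟩ ⟨y e, hyW e he⟩
    (Or.inl ⟨rfl, rfl⟩)
  exact ⟨t, _, _, _, _, HasBicycle.of_walk (u := fun l => (u l : V)) hc hadj
    ⟨i, by omega⟩ ⟨j, by omega⟩ (congrArg _ hui) (congrArg _ huj)⟩

/-! ### First-moment bound for bicycles. -/

theorem measureReal_pi_cylinder {ι κ Ω : Type*} [Fintype ι] [Fintype κ] [MeasurableSpace Ω]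
    (μ : Measure Ω) [IsProbabilityMeasure μ] {c : κ → ι} (hc : Function.Injective c)
    (A : κ → Set Ω) :
    (Measure.pi fun _ : ι => μ).real {Φ | ∀ l, Φ (c l) ∈ A l} = ∏ l, μ.real (A l) := by
  have h : {Φ : ι → Ω | ∀ l, Φ (c l) ∈ A l} =
      ((Finset.univ.map ⟨c, hc⟩ : Finset ι) : Set ι).pi
        (Function.extend c A fun _ => Set.univ) := by
    ext Φ
    simp [Set.mem_pi, hc.extend_apply]
  rw [h, measureReal_def, Measure.pi_pi_finset, ENNReal.toReal_prod, Finset.prod_map]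
  simp [hc.extend_apply, measureReal_def]

/-- Distinct edges are independent, so the probabilities multiply. Each interior position touches
two edges and gives `q ^ 2`; the two ends touch one edge each and together give at most `R`. -/
theorem measureReal_hasBicycle_le {ι Ω V : Type*} [Fintype ι] [MeasurableSpace Ω]
    (μ : Measure Ω) [IsProbabilityMeasure μ] (E : V → V → Set Ω) (q : V → ℝ) {κ R : ℝ}
    (hκ : 0 ≤ κ) (hR : ∀ i j, q i * q j ≤ R)
    (hE : ∀ i j, μ.real (E i j) ≤ κ * (q i * q j)) (t : ℕ) (v : Fin (t + 1) → V)
    (i j : Fin (t + 1)) (c : Fin (t + 2) → ι) :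
    (Measure.pi fun _ : ι => μ).real {Φ | HasBicycle (fun c i j => Φ c ∈ E i j) t v i j c} ≤
      κ ^ (t + 2) * R * ∏ l, q (v l) ^ 2 := by
  have hP : 0 ≤ ∏ l, q (v l) ^ 2 := Finset.prod_nonneg fun _ _ => sq_nonneg _
  have hR0 : 0 ≤ R := (mul_self_nonneg _).trans (hR (v i) (v i))
  by_cases hc : Function.Injective c
  · set u : Fin (t + 3) → V := Fin.cons (v i) (Fin.snoc v (v j) : Fin (t + 2) → V) with hu
    have hprod : ∏ l : Fin (t + 2), κ * (q (u l.castSucc) * q (u l.succ)) =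
        κ ^ (t + 2) * (q (v i) * q (v j)) * ∏ l, q (v l) ^ 2 := by
      have h1 : ∏ l : Fin (t + 2), q (u l.castSucc) = q (v i) * ∏ l, q (v l) := by
        rw [hu, Fin.cons_snoc_eq_snoc_cons]
        simp only [Fin.snoc_castSucc]
        rw [Fin.prod_univ_succ]
        simp
      have h2 : ∏ l : Fin (t + 2), q (u l.succ) = (∏ l, q (v l)) * q (v j) := by
        rw [Fin.prod_univ_castSucc]
        simp [hu]
      rw [Finset.prod_mul_distrib, Finset.prod_mul_distrib, h1, h2, Finset.prod_pow,
        Finset.prod_const, Finset.card_univ, Fintype.card_fin]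
      ring
    calc _ ≤ (Measure.pi fun _ : ι => μ).real
          {Φ | ∀ l, Φ (c l) ∈ E (u l.castSucc) (u l.succ)} := measureReal_mono fun Φ h => h.2
      _ = ∏ l, μ.real (E (u l.castSucc) (u l.succ)) := measureReal_pi_cylinder μ hc _
      _ ≤ ∏ l : Fin (t + 2), κ * (q (u l.castSucc) * q (u l.succ)) :=
        Finset.prod_le_prod (fun _ _ => measureReal_nonneg) fun _ _ => hE _ _
      _ ≤ _ := by
        rw [hprod]
        gcongr
        exact hR _ _
  · have : {Φ : ι → Ω | HasBicycle (fun c i j => Φ c ∈ E i j) t v i j c} = ∅ :=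
      Set.eq_empty_of_forall_notMem fun Φ h => hc h.1
    rw [this, measureReal_empty]
    positivity

theorem measureReal_exists_bicycle_le {ι Ω V : Type*} [Fintype ι] [Fintype V] [MeasurableSpace Ω]
    (μ : Measure Ω) [IsProbabilityMeasure μ] (E : V → V → Set Ω) (q : V → ℝ) {κ R : ℝ}
    (hκ : 0 ≤ κ) (hR0 : 0 ≤ R) (hR : ∀ i j, q i * q j ≤ R)
    (hE : ∀ i j, μ.real (E i j) ≤ κ * (q i * q j))
    (hsmall : Fintype.card ι * κ * ∑ i, q i ^ 2 ≤ 1 / 8) :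
    (Measure.pi fun _ : ι => μ).real
      {Φ | ∃ t v i j c, HasBicycle (fun c i j => Φ c ∈ E i j) t v i j c} ≤
      Fintype.card ι * κ * R := by
  classical
  set m : ℕ := Fintype.card ι with hm
  set S := ∑ i, q i ^ 2 with hS
  have hS0 : 0 ≤ S := Finset.sum_nonneg fun _ _ => sq_nonneg _
  have hone : ∀ t : ℕ, (Measure.pi fun _ : ι => μ).real
      {Φ | ∃ v i j c, HasBicycle (fun c i j => Φ c ∈ E i j) t v i j c} ≤
      m * κ * R * (1 / 2 * (1 / 2) ^ t) := by
    intro t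
    have hunion : {Φ : ι → Ω | ∃ v i j c, HasBicycle (fun c i j => Φ c ∈ E i j) t v i j c} =
        ⋃ x : (Fin (t + 1) → V) × Fin (t + 1) × Fin (t + 1) × (Fin (t + 2) → ι),
          {Φ | HasBicycle (fun c i j => Φ c ∈ E i j) t x.1 x.2.1 x.2.2.1 x.2.2.2} := by
      ext Φ
      simp
    -- The factor `(t + 1) ^ 2` counts the choices of `i` and `j`; against `(1 / 8) ^ (t + 1)` it
    -- still leaves a geometric series of ratio `1 / 2`.
    have hsq : ((t : ℝ) + 1) ^ 2 ≤ 4 ^ (t + 1) := by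
      have h1 : ((t + 1 : ℕ) : ℝ) < 2 ^ (t + 1) := by exact_mod_cast Nat.lt_two_pow_self
      push_cast at h1
      calc ((t : ℝ) + 1) ^ 2 ≤ (2 ^ (t + 1)) ^ 2 := by gcongr
        _ = 4 ^ (t + 1) := by rw [← pow_mul, mul_comm, pow_mul]; norm_num
    rw [hunion]
    calc _ ≤ ∑ x : (Fin (t + 1) → V) × Fin (t + 1) × Fin (t + 1) × (Fin (t + 2) → ι),
          κ ^ (t + 2) * R * ∏ l, q (x.1 l) ^ 2 :=
        (measureReal_iUnion_fintype_le _).trans (Finset.sum_le_sum fun x _ =>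
          measureReal_hasBicycle_le μ E q hκ hR hE t _ _ _ _)
      _ = κ ^ (t + 2) * R * ((t + 1) ^ 2 * m ^ (t + 2)) * S ^ (t + 1) := by
        have hpow : S ^ (t + 1) = ∑ v : Fin (t + 1) → V, ∏ l, q (v l) ^ 2 := by
          have := Finset.prod_univ_sum (fun _ : Fin (t + 1) => (Finset.univ : Finset V))
            (fun _ i => q i ^ 2)
          rw [Fintype.piFinset_univ] at this
          rw [← this]
          simp [hS]
        rw [Fintype.sum_prod_type]
        simp only [Finset.sum_const, Finset.card_univ, Fintype.card_prod, Fintype.card_fin,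
          Fintype.card_fun, nsmul_eq_mul]
        rw [← Finset.mul_sum, ← Finset.mul_sum, ← hpow, ← hm]
        push_cast
        ring
      _ = m * κ * R * ((t + 1) ^ 2 * (m * κ * S) ^ (t + 1)) := by ring
      _ ≤ m * κ * R * (4 ^ (t + 1) * (1 / 8) ^ (t + 1)) := by gcongr
      _ = _ := by
        rw [← mul_pow, pow_succ]
        norm_num [pow_succ]
        ring_nf
        simp
  -- A bicycle uses `t + 2` distinct edges out of `m`, so only finitely many `t` matter.
  have hsub : {Φ : ι → Ω | ∃ t v i j c, HasBicycle (fun c i j => Φ c ∈ E i j) t v i j c} ⊆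
      ⋃ t ∈ Finset.range m, {Φ | ∃ v i j c, HasBicycle (fun c i j => Φ c ∈ E i j) t v i j c} := by
    rintro Φ ⟨t, v, i, j, c, h⟩
    have := Fintype.card_le_of_injective c h.1
    rw [Fintype.card_fin] at this
    simp only [Set.mem_iUnion, Finset.mem_range]
    exact ⟨t, by omega, v, i, j, c, h⟩
  calc _ ≤ ∑ t ∈ Finset.range m, m * κ * R * (1 / 2 * (1 / 2) ^ t) :=
        (measureReal_mono hsub (measure_ne_top _ _)).trans ((measureReal_biUnion_finset_le _ _).trans
          (Finset.sum_le_sum fun t _ => hone t))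
    _ = m * κ * R * (1 / 2 * ∑ t ∈ Finset.range m, (1 / 2 : ℝ) ^ t) := by
      rw [← Finset.mul_sum, ← Finset.mul_sum]
    _ ≤ m * κ * R * 1 := by
      gcongr
      linarith [sum_geometric_two_le m]
    _ = _ := mul_one _

/-! ### Power sums of power-law weights. -/

namespace FollowsPowerLaw

variable {n : ℕ} {w : Fin n → ℝ} {β c₁ c₂ : ℝ}

theorem le_weight (h : FollowsPowerLaw w β c₁ c₂) (i : Fin n) : c₁ ≤ w i :=
  h.min_lower.trans (ciInf_le (Set.finite_range w).bddBelow i)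

theorem weight_le (h : FollowsPowerLaw w β c₁ c₂) (i : Fin n) :
    w i ≤ c₂ * (n : ℝ) ^ (1 / (β - 1)) :=
  (le_ciSup (Set.finite_range w).bddAbove i).trans h.max_upper

theorem const_le (h : FollowsPowerLaw w β c₁ c₂) : c₁ ≤ c₂ := h.min_lower.trans h.min_upper

theorem card_le (h : FollowsPowerLaw w β c₁ c₂) (hc₁ : 0 < c₁) {x : ℝ} (hx : ⨅ i, w i ≤ x) :
    ((Finset.univ.filter fun i => x ≤ w i).card : ℝ) ≤ c₂ * n * x ^ (1 - β) := by
  have hx0 : 0 < x := hc₁.trans_le (h.min_lower.trans hx)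
  have hc₂ : 0 < c₂ := hc₁.trans_le h.const_le
  by_cases hx' : x ≤ ⨆ i, w i
  · have := h.tail_upper x ⟨hx, hx'⟩
    rcases Nat.eq_zero_or_pos n with rfl | hn
    · simp
    · rw [weightTail, div_le_iff₀ (by positivity), Nat.card_eq_fintype_card,
        Fintype.card_subtype] at this
      linarith
  · rw [Finset.filter_false_of_mem, Finset.card_empty, Nat.cast_zero]
    · positivity
    · exact fun i _ hi => hx' (hi.trans (le_ciSup (Set.finite_range w).bddAbove i))

end FollowsPowerLaw

/-- Dyadic decomposition: the weights in `[2 ^ j * x, 2 ^ (j + 1) * x)` contribute at most a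
constant times `n * (2 ^ j * x) ^ (a + 1 - β)`, which is geometric in `j` with ratio `2 ^ (a + 1 -
β) < 1`. -/
theorem exists_sum_rpow_le {β c₁ c₂ a : ℝ} (hc₁ : 0 < c₁) (ha : 0 ≤ a) (haβ : a < β - 1) :
    ∃ C, 0 ≤ C ∧ ∀ (n : ℕ) (w : Fin n → ℝ), FollowsPowerLaw w β c₁ c₂ → ∀ x, ⨅ i, w i ≤ x →
      ∑ i with x ≤ w i, w i ^ a ≤ C * n * x ^ (a + 1 - β) := by
  by_cases hc₂ : c₂ < c₁
  · exact ⟨0, le_rfl, fun n w h => absurd h.const_le (not_le.2 hc₂)⟩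
  have hc₂ : 0 < c₂ := hc₁.trans_le (not_lt.1 hc₂)
  have hr1 : (2 : ℝ) ^ (a + 1 - β) < 1 := Real.rpow_lt_one_of_one_lt_of_neg (by norm_num)
    (by linarith)
  have hr0 : 0 < (2 : ℝ) ^ (a + 1 - β) := by positivity
  set r := (2 : ℝ) ^ (a + 1 - β) with hr
  have hgeom : ∀ N, ∑ j ∈ Finset.range N, r ^ j ≤ (1 - r)⁻¹ := fun N => by
    rw [← tsum_geometric_of_lt_one hr0.le hr1]
    exact (summable_geometric_of_lt_one hr0.le hr1).sum_le_tsum _ fun _ _ => by positivity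
  have h1r : 0 < 1 - r := by linarith
  refine ⟨2 ^ a * c₂ * (1 - r)⁻¹, by positivity, fun n w h x hx => ?_⟩
  have hx0 : 0 < x := hc₁.trans_le (h.min_lower.trans hx)
  -- `N` dyadic scales reach beyond the largest weight.
  obtain ⟨N, hN⟩ := pow_unbounded_of_one_lt (c₂ * (n : ℝ) ^ (1 / (β - 1)) / x) one_lt_two
  have hpt : ∀ i ∈ Finset.univ.filter (fun i => x ≤ w i), w i ^ a ≤
      ∑ j ∈ Finset.range N, if 2 ^ j * x ≤ w i then 2 ^ a * (2 ^ j * x) ^ a else 0 := by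
    intro i hi
    have hi : x ≤ w i := (Finset.mem_filter.1 hi).2
    obtain ⟨j, hj1, hj2⟩ := exists_nat_pow_near ((one_le_div hx0).2 hi) (one_lt_two (α := ℝ))
    rw [le_div_iff₀ hx0] at hj1
    rw [div_lt_iff₀ hx0] at hj2
    have hjN : j < N := by
      have : (2 : ℝ) ^ j < 2 ^ N := lt_of_le_of_lt
        (((le_div_iff₀ hx0).2 hj1).trans (div_le_div_of_nonneg_right (h.weight_le i) hx0.le)) hN
      exact (pow_lt_pow_iff_right₀ one_lt_two).1 this
    calc w i ^ a ≤ (2 * (2 ^ j * x)) ^ a :=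
          Real.rpow_le_rpow (hx0.le.trans hi) (hj2.le.trans_eq (by ring)) ha
      _ = if 2 ^ j * x ≤ w i then 2 ^ a * (2 ^ j * x) ^ a else 0 := by
          rw [if_pos hj1, Real.mul_rpow (by norm_num) (by positivity)]
      _ ≤ _ := Finset.single_le_sum
        (f := fun j => if 2 ^ j * x ≤ w i then (2 : ℝ) ^ a * (2 ^ j * x) ^ a else 0)
        (fun j _ => by split_ifs <;> positivity) (Finset.mem_range.2 hjN)
  calc ∑ i with x ≤ w i, w i ^ a
      ≤ ∑ i with x ≤ w i, ∑ j ∈ Finset.range N,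
          (if 2 ^ j * x ≤ w i then (2 : ℝ) ^ a * (2 ^ j * x) ^ a else 0) :=
        Finset.sum_le_sum hpt
    _ ≤ ∑ i, ∑ j ∈ Finset.range N,
          (if 2 ^ j * x ≤ w i then (2 : ℝ) ^ a * (2 ^ j * x) ^ a else 0) :=
        Finset.sum_le_sum_of_subset_of_nonneg (Finset.filter_subset _ _)
          fun i _ _ => Finset.sum_nonneg fun j _ => by split_ifs <;> positivity
    _ = ∑ j ∈ Finset.range N, ((Finset.univ.filter fun i => 2 ^ j * x ≤ w i).card : ℝ) *
          (2 ^ a * (2 ^ j * x) ^ a) := by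
        rw [Finset.sum_comm]
        refine Finset.sum_congr rfl fun j _ => ?_
        rw [← Finset.sum_filter, Finset.sum_const, nsmul_eq_mul]
    _ ≤ ∑ j ∈ Finset.range N, c₂ * n * (2 ^ j * x) ^ (1 - β) * (2 ^ a * (2 ^ j * x) ^ a) := by
        refine Finset.sum_le_sum fun j _ => ?_
        gcongr
        refine h.card_le hc₁ (hx.trans ?_)
        exact le_mul_of_one_le_left hx0.le (one_le_pow₀ one_le_two)
    _ = ∑ j ∈ Finset.range N, 2 ^ a * c₂ * n * x ^ (a + 1 - β) * r ^ j := by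
        refine Finset.sum_congr rfl fun j _ => ?_
        have h1 : (2 ^ j * x) ^ (1 - β) * (2 ^ j * x) ^ a = r ^ j * x ^ (a + 1 - β) := by
          rw [← Real.rpow_add (by positivity), Real.mul_rpow (by positivity) hx0.le,
            show 1 - β + a = a + 1 - β by ring, hr, ← Real.rpow_natCast, ← Real.rpow_natCast,
            ← Real.rpow_mul (by norm_num), ← Real.rpow_mul (by norm_num), mul_comm (j : ℝ)]
        linear_combination (c₂ * n * 2 ^ a) * h1
    _ = 2 ^ a * c₂ * n * x ^ (a + 1 - β) * ∑ j ∈ Finset.range N, r ^ j := by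
        rw [Finset.mul_sum]
    _ ≤ 2 ^ a * c₂ * n * x ^ (a + 1 - β) * (1 - r)⁻¹ := by
        gcongr
        exact hgeom N
    _ = _ := by ring

/-! ### A random clause and its two lightest variables. -/

section varDist

variable {n : ℕ} {w : Fin n → ℝ}

theorem varDist_real_apply (hw : ∀ i, 0 ≤ w i) (A : Set (Fin n)) [DecidablePred (· ∈ A)] :
    (varDist w).real A = (∑ i with i ∈ A, w i) / ∑ i, w i := by
  have hS : 0 ≤ ∑ i, w i := Finset.sum_nonneg fun i _ => hw i
  rw [measureReal_def, varDist, Measure.finsetSum_apply, ENNReal.toReal_sum]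
  · rw [Finset.sum_div, Finset.sum_filter]
    refine Finset.sum_congr rfl fun i _ => ?_
    by_cases hi : i ∈ A <;> simp [hi, div_nonneg (hw i) hS]
  · intro i _
    by_cases hi : i ∈ A <;> simp [hi]

theorem varDist_real_singleton (hw : ∀ i, 0 ≤ w i) (i : Fin n) :
    (varDist w).real {i} = w i / ∑ j, w j := by
  rw [varDist_real_apply hw]
  simp [Finset.filter_eq']

theorem isProbabilityMeasure_varDist (hw : ∀ i, 0 ≤ w i) (hS : 0 < ∑ i, w i) :
    IsProbabilityMeasure (varDist w) := by
  constructor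
  have h := varDist_real_apply hw Set.univ
  simp only [Set.mem_univ, Finset.filter_true] at h
  rw [div_self hS.ne', measureReal_def] at h
  rwa [← ENNReal.toReal_eq_one_iff]

end varDist

/-- Two given positions collide with probability `∑ p_i ^ 2 ≤ p`; the union bound runs over all
pairs of positions. -/
theorem measureReal_pi_not_injective_le {k : ℕ} {V : Type*} [Fintype V] [MeasurableSpace V]
    [MeasurableSingletonClass V] (μ : Measure V) [IsProbabilityMeasure μ] {p : ℝ}
    (hp : ∀ i, μ.real {i} ≤ p) :
    (Measure.pi fun _ : Fin k => μ).real {v | ¬ Function.Injective v} ≤ k ^ 2 * p := by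
  have hp0 : 0 ≤ p := by
    have := μ.nonempty_of_neZero
    exact measureReal_nonneg.trans (hp (Classical.arbitrary V))
  have hsub : {v : Fin k → V | ¬ Function.Injective v} ⊆
      ⋃ x : Fin k × Fin k, {v | v x.1 = v x.2 ∧ x.1 ≠ x.2} := by
    intro v hv
    simp only [Set.mem_ofPred_eq, Function.Injective] at hv
    push Not at hv
    obtain ⟨i, j, h, hij⟩ := hv
    exact Set.mem_iUnion.2 ⟨(i, j), h, hij⟩
  have hpair : ∀ x : Fin k × Fin k,
      (Measure.pi fun _ : Fin k => μ).real {v | v x.1 = v x.2 ∧ x.1 ≠ x.2} ≤ p := by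
    rintro ⟨j₁, j₂⟩
    by_cases hj : j₁ = j₂
    · simpa [hj] using hp0
    have hinj : Function.Injective ![j₁, j₂] := by
      intro a b
      fin_cases a <;> fin_cases b <;> simp [hj, Ne.symm hj]
    have hunion : {v : Fin k → V | v j₁ = v j₂ ∧ j₁ ≠ j₂} ⊆
        ⋃ i, {v | ∀ l, v (![j₁, j₂] l) ∈ ({i} : Set V)} := by
      rintro v ⟨hv, -⟩
      refine Set.mem_iUnion.2 ⟨v j₂, fun l => ?_⟩
      fin_cases l <;> simp [hv]
    calc _ ≤ ∑ i, (Measure.pi fun _ : Fin k => μ).real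
          {v | ∀ l, v (![j₁, j₂] l) ∈ ({i} : Set V)} :=
          (measureReal_mono hunion (measure_ne_top _ _)).trans (measureReal_iUnion_fintype_le _)
      _ = ∑ i, μ.real {i} * μ.real {i} := by
          refine Finset.sum_congr rfl fun i _ => ?_
          rw [measureReal_pi_cylinder μ hinj fun _ => {i}]
          simp [sq]
      _ ≤ ∑ i, p * μ.real {i} := by
          gcongr with i
          exact hp i
      _ = p := by
          rw [← Finset.mul_sum, sum_measureReal_singleton]
          simp
  calc _ ≤ ∑ x : Fin k × Fin k,
        (Measure.pi fun _ : Fin k => μ).real {v | v x.1 = v x.2 ∧ x.1 ≠ x.2} :=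
        (measureReal_mono hsub (measure_ne_top _ _)).trans (measureReal_iUnion_fintype_le _)
    _ ≤ ∑ x : Fin k × Fin k, p := Finset.sum_le_sum fun x _ => hpair x
    _ = _ := by
      simp [Fintype.card_prod, sq]

/-- The variables `i` and `j` occur in the clause, at two different places, and all other variables
of the clause are at least as heavy as both of them. -/
def lightestPair (k : ℕ) {n : ℕ} (w : Fin n → ℝ) (i j : Fin n) : Set (Clause k n) :=
  {c | ∃ a b, a ≠ b ∧ c.1 a = i ∧ c.1 b = j ∧
    ∀ l, l ≠ a → l ≠ b → max (w i) (w j) ≤ w (c.1 l)}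

theorem exists_mem_lightestPair {k : ℕ} (hk : 2 ≤ k) {n : ℕ} (w : Fin n → ℝ) (c : Clause k n) :
    ∃ a b, c ∈ lightestPair k w (c.1 a) (c.1 b) := by
  obtain ⟨a, -, ha⟩ := Finset.exists_min_image (Finset.univ : Finset (Fin k)) (fun l => w (c.1 l))
    ⟨⟨0, by omega⟩, Finset.mem_univ _⟩
  obtain ⟨b, hb, hb'⟩ := Finset.exists_min_image (Finset.univ.erase a) (fun l => w (c.1 l))
    (by rw [← Finset.card_pos, Finset.card_erase_of_mem (Finset.mem_univ _), Finset.card_univ,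
          Fintype.card_fin]; omega)
  exact ⟨a, b, a, b, (Finset.ne_of_mem_erase hb).symm, rfl, rfl, fun l hla hlb =>
    max_le (ha l (Finset.mem_univ _)) (hb' l (Finset.mem_erase.2 ⟨hla, Finset.mem_univ _⟩))⟩

theorem lightestPair_comm (k : ℕ) {n : ℕ} (w : Fin n → ℝ) (i j : Fin n) :
    lightestPair k w i j = lightestPair k w j i := by
  have : ∀ i j, lightestPair k w i j ⊆ lightestPair k w j i := by
    rintro i j c ⟨a, b, hab, ha, hb, h⟩
    exact ⟨b, a, hab.symm, hb, ha, fun l h1 h2 => max_comm (w i) (w j) ▸ h l h2 h1⟩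
  exact (this i j).antisymm (this j i)

theorem measureReal_pi_lightestPair_le {k n : ℕ} (w : Fin n → ℝ)
    (μ : Measure (Fin n)) [IsProbabilityMeasure μ] (i j : Fin n) :
    (Measure.pi fun _ : Fin k => μ).real {v | ∃ a b, a ≠ b ∧ v a = i ∧ v b = j ∧
      ∀ l, l ≠ a → l ≠ b → max (w i) (w j) ≤ w (v l)} ≤
      k ^ 2 * (μ.real {i} * μ.real {j} * μ.real {l | max (w i) (w j) ≤ w l} ^ (k - 2)) := by
  set T := {l | max (w i) (w j) ≤ w l} with hT
  have hsub : {v : Fin k → Fin n | ∃ a b, a ≠ b ∧ v a = i ∧ v b = j ∧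
      ∀ l, l ≠ a → l ≠ b → max (w i) (w j) ≤ w (v l)} ⊆
      ⋃ x : Fin k × Fin k, {v | x.1 ≠ x.2 ∧
        ∀ l, v l ∈ if l = x.1 then {i} else if l = x.2 then {j} else T} := by
    rintro v ⟨a, b, hab, ha, hb, h⟩
    refine Set.mem_iUnion.2 ⟨(a, b), hab, fun l => ?_⟩
    simp only
    split_ifs with h1 h2
    · simp [h1, ha]
    · simp [h2, hb]
    · exact h l h1 h2
  have hpair : ∀ x : Fin k × Fin k, (Measure.pi fun _ : Fin k => μ).real {v | x.1 ≠ x.2 ∧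
      ∀ l, v l ∈ if l = x.1 then {i} else if l = x.2 then {j} else T} ≤
      μ.real {i} * μ.real {j} * μ.real T ^ (k - 2) := by
    rintro ⟨a, b⟩
    by_cases hab : a = b
    · simp only [hab, ne_eq, not_true_eq_false, false_and, Set.ofPred_false, measureReal_empty]
      positivity
    have hset : {v : Fin k → Fin n | a ≠ b ∧
        ∀ l, v l ∈ if l = a then {i} else if l = b then {j} else T} =
        {v | ∀ l, v (id l) ∈ if l = a then {i} else if l = b then {j} else T} := by
      simp [hab]
    simp only
    rw [hset, measureReal_pi_cylinder μ Function.injective_id,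
      ← Finset.mul_prod_erase _ _ (Finset.mem_univ a),
      ← Finset.mul_prod_erase _ _ (Finset.mem_erase.2 ⟨Ne.symm hab, Finset.mem_univ b⟩),
      Finset.prod_congr rfl (g := fun _ => μ.real T) fun l hl => by
        rw [if_neg (by simp at hl; tauto), if_neg (by simp at hl; tauto)],
      Finset.prod_const, Finset.card_erase_of_mem (by simp [Ne.symm hab]),
      Finset.card_erase_of_mem (Finset.mem_univ _), Finset.card_univ, Fintype.card_fin,
      if_pos rfl, if_neg (Ne.symm hab), if_pos rfl, Nat.sub_sub, mul_assoc]
  calc _ ≤ ∑ x : Fin k × Fin k, μ.real {i} * μ.real {j} * μ.real T ^ (k - 2) :=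
        ((measureReal_mono hsub (measure_ne_top _ _)).trans
          (measureReal_iUnion_fintype_le _)).trans (Finset.sum_le_sum fun x _ => hpair x)
    _ = _ := by
      simp [Fintype.card_prod, sq]

section randomClause

variable {k n : ℕ} {w : Fin n → ℝ} {p : ℝ}

/-- Hence conditioning on distinct variables at most doubles a probability. -/
theorem half_le_measureReal_injective (hw : ∀ i, 0 ≤ w i) (hS : 0 < ∑ i, w i)
    (hp : ∀ i, w i / ∑ j, w j ≤ p) (hkp : (k : ℝ) ^ 2 * p ≤ 1 / 2) :
    1 / 2 ≤ (Measure.pi fun _ : Fin k => varDist w).real {v | Function.Injective v} := by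
  have := isProbabilityMeasure_varDist hw hS
  have h1 := measureReal_pi_not_injective_le (k := k) (varDist w)
    fun i => (varDist_real_singleton hw i).trans_le (hp i)
  have h2 := probReal_compl_eq_one_sub (μ := Measure.pi fun _ : Fin k => varDist w)
    (s := {v | Function.Injective v}) (Set.toFinite _).measurableSet
  rw [Set.compl_ofPred] at h2
  linarith

theorem isProbabilityMeasure_randomClause (hw : ∀ i, 0 ≤ w i) (hS : 0 < ∑ i, w i)
    (hp : ∀ i, w i / ∑ j, w j ≤ p) (hkp : (k : ℝ) ^ 2 * p ≤ 1 / 2) :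
    IsProbabilityMeasure (randomClause k w) := by
  have := isProbabilityMeasure_varDist hw hS
  have h := half_le_measureReal_injective hw hS hp hkp
  have : IsProbabilityMeasure (randomVars k w) := cond_isProbabilityMeasure fun h0 => by
    rw [measureReal_def, h0] at h
    norm_num at h
  unfold randomClause
  infer_instance

theorem randomClause_real_lightestPair_le (hw : ∀ i, 0 ≤ w i) (hS : 0 < ∑ i, w i)
    (hp : ∀ i, w i / ∑ j, w j ≤ p) (hkp : (k : ℝ) ^ 2 * p ≤ 1 / 2) (i j : Fin n) :
    (randomClause k w).real (lightestPair k w i j) ≤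
      2 * k ^ 2 * (w i / (∑ l, w l) * (w j / ∑ l, w l) *
        ((∑ l with max (w i) (w j) ≤ w l, w l) / ∑ l, w l) ^ (k - 2)) := by
  have := isProbabilityMeasure_varDist hw hS
  have h := half_le_measureReal_injective hw hS hp hkp
  set A : Set (Fin k → Fin n) := {v | ∃ a b, a ≠ b ∧ v a = i ∧ v b = j ∧
      ∀ l, l ≠ a → l ≠ b → max (w i) (w j) ≤ w (v l)} with hA
  have hset : lightestPair k w i j = A ×ˢ Set.univ := by
    ext c
    simp [lightestPair, hA]
  have hbox := measureReal_pi_lightestPair_le (k := k) w (varDist w) i j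
  rw [varDist_real_singleton hw, varDist_real_singleton hw, varDist_real_apply hw, ← hA] at hbox
  rw [hset, randomClause, measureReal_prod_prod, probReal_univ, mul_one, randomVars,
    measureReal_def, cond_apply (Set.toFinite _).measurableSet, ENNReal.toReal_mul,
    ENNReal.toReal_inv, ← measureReal_def, ← measureReal_def]
  calc _ ≤ (1 / 2 : ℝ)⁻¹ * (Measure.pi fun _ : Fin k => varDist w).real A := by
        gcongr
        exacts [measure_ne_top _ _, Set.inter_subset_right]
    _ ≤ _ := by
        rw [one_div, inv_inv, mul_assoc]
        gcongr
        exact hbox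

end randomClause

/-! ### From bicycles to satisfiability, and the choice of constants. -/

theorem Formula.satisfiable_of_injective {k n m : ℕ} {Φ : Formula k n m} {φ : Fin m → Fin n}
    (hφ : Function.Injective φ) (h : ∀ c, ∃ l, φ c = (Φ c).1 l) : Φ.Satisfiable := by
  choose l hl using h
  refine ⟨Function.extend φ (fun c => (Φ c).2 (l c)) fun _ => false, fun c => ⟨l c, ?_⟩⟩
  rw [← hl, hφ.extend_apply]

theorem Formula.exists_bicycle_of_not_satisfiable {k n m : ℕ} (hk : 2 ≤ k) (w : Fin n → ℝ)
    {Φ : Formula k n m} (hΦ : ¬ Φ.Satisfiable) :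
    ∃ t v i j c, HasBicycle (fun c i j => Φ c ∈ lightestPair k w i j) t v i j c := by
  choose a b hab using fun c => exists_mem_lightestPair hk w (Φ c)
  rcases exists_injective_or_bicycle (fun c => (Φ c).1 (a c)) (fun c => (Φ c).1 (b c)) with
    ⟨φ, hφ, h⟩ | ⟨t, v, i, j, c, hc, h⟩
  · refine absurd (satisfiable_of_injective hφ fun c => ?_) hΦ
    rcases h c with h | h
    · exact ⟨a c, h⟩
    · exact ⟨b c, h⟩
  · refine ⟨t, v, i, j, c, hc, fun l => ?_⟩
    rcases h l with ⟨h1, h2⟩ | ⟨h1, h2⟩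
    · rw [← h1, ← h2]
      exact hab _
    · rw [← h1, ← h2, lightestPair_comm]
      exact hab _

theorem FollowsPowerLaw.le_sum {n : ℕ} {w : Fin n → ℝ} {β c₁ c₂ : ℝ}
    (h : FollowsPowerLaw w β c₁ c₂) : c₁ * n ≤ ∑ i, w i := by
  have := Finset.card_nsmul_le_sum Finset.univ w c₁ fun i _ => h.le_weight i
  rwa [Finset.card_univ, Fintype.card_fin, nsmul_eq_mul, mul_comm] at this

/-- The bound on the probability that a random clause has `i` and `j` as its lightest variables. -/
theorem exists_lightestPair_bound {k : ℕ} (hk : 2 ≤ k) {β c₁ c₂ a : ℝ} (hc₁ : 0 < c₁)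
    (hβ : 2 < β) (ha : 2 + (2 - β) * ((k : ℝ) - 2) ≤ a) :
    ∃ K, 0 ≤ K ∧ ∀ (n : ℕ) (w : Fin n → ℝ), 0 < n → FollowsPowerLaw w β c₁ c₂ → ∀ i j,
      2 * k ^ 2 * (w i / (∑ l, w l) * (w j / ∑ l, w l) *
        ((∑ l with max (w i) (w j) ≤ w l, w l) / ∑ l, w l) ^ (k - 2)) ≤
      K / n ^ 2 * (w i ^ (a / 2) * w j ^ (a / 2)) := by
  obtain ⟨C, hC, hsum⟩ := exists_sum_rpow_le (β := β) (c₁ := c₁) (c₂ := c₂) (a := 1) hc₁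
    zero_le_one (by linarith)
  set s := (2 - β) * ((k : ℝ) - 2) with hs
  have hk' : (2 : ℝ) ≤ k := by exact_mod_cast hk
  have hs0 : s ≤ 0 := mul_nonpos_of_nonpos_of_nonneg (by linarith) (by linarith)
  refine ⟨2 * k ^ 2 * (1 / c₁ ^ 2) * (C / c₁) ^ (k - 2) * (c₁ ^ 2) ^ ((2 + s - a) / 2),
    by positivity, fun n w hn h i j => ?_⟩
  have hn' : (0 : ℝ) < n := by exact_mod_cast hn
  have hw : ∀ i, 0 < w i := fun i => hc₁.trans_le (h.le_weight i)
  have hS := h.le_sum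
  set S := ∑ l, w l
  have hS0 : 0 < S := (mul_pos hc₁ hn').trans_le hS
  set M := max (w i) (w j) with hM
  have hM0 : 0 < M := (hw i).trans_le (le_max_left _ _)
  have hwi := hw i
  have hwj := hw j
  have htail : (∑ l with M ≤ w l, w l) / S ≤ C / c₁ * M ^ (2 - β) := by
    have h1 := hsum n w h M
      ((ciInf_le (Set.finite_range w).bddBelow i).trans (le_max_left _ _))
    simp only [Real.rpow_one] at h1
    calc _ ≤ (C * n * M ^ (1 + 1 - β)) / (c₁ * n) := by gcongr
      _ = _ := by
        rw [show (1 : ℝ) + 1 - β = 2 - β by ring]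
        field_simp
  have htail0 : 0 ≤ (∑ l with M ≤ w l, w l) / S :=
    div_nonneg (Finset.sum_nonneg fun l _ => (hw l).le) hS0.le
  -- As `s ≤ 0` and `w i * w j ≤ M * M`, the maximum can be traded for a product, so that the bound
  -- factors over `i` and `j`.
  have hMs : (M ^ (2 - β)) ^ (k - 2) ≤ (w i * w j) ^ (s / 2) := by
    calc (M ^ (2 - β)) ^ (k - 2) = (M * M) ^ (s / 2) := by
          rw [← Real.rpow_natCast, ← Real.rpow_mul hM0.le, Nat.cast_sub hk,
            Real.mul_rpow hM0.le hM0.le, ← Real.rpow_add hM0]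
          congr 1
          push_cast
          ring
      _ ≤ _ := Real.rpow_le_rpow_of_nonpos (by positivity)
          (mul_le_mul (le_max_left _ _) (le_max_right _ _) hwj.le hM0.le) (by linarith)
  -- The exponent `1 + s / 2` is raised to `a / 2` at the cost of a constant, because the weights
  -- are at least `c₁`.
  have hpow : w i * w j * (w i * w j) ^ (s / 2) ≤
      (c₁ ^ 2) ^ ((2 + s - a) / 2) * (w i ^ (a / 2) * w j ^ (a / 2)) := by
    have hij : 0 < w i * w j := by positivity
    calc w i * w j * (w i * w j) ^ (s / 2)
        = (w i * w j) ^ ((2 + s - a) / 2) * (w i * w j) ^ (a / 2) := by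
          nth_rewrite 1 [← Real.rpow_one (w i * w j)]
          rw [← Real.rpow_add hij, ← Real.rpow_add hij]
          congr 1
          ring
      _ ≤ _ := by
          rw [Real.mul_rpow hwi.le hwj.le (z := a / 2)]
          refine mul_le_mul_of_nonneg_right ?_ (by positivity)
          refine Real.rpow_le_rpow_of_nonpos (by positivity) ?_ (by linarith)
          rw [sq]
          exact mul_le_mul (h.le_weight i) (h.le_weight j) hc₁.le hwi.le
  calc _ ≤ 2 * k ^ 2 * (w i / (c₁ * n) * (w j / (c₁ * n)) *
        (C / c₁ * M ^ (2 - β)) ^ (k - 2)) := by gcongr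
    _ = 2 * k ^ 2 * (1 / c₁ ^ 2) * (C / c₁) ^ (k - 2) / n ^ 2 *
        (w i * w j * (M ^ (2 - β)) ^ (k - 2)) := by
      rw [mul_pow]
      field_simp
    _ ≤ 2 * k ^ 2 * (1 / c₁ ^ 2) * (C / c₁) ^ (k - 2) / n ^ 2 *
        ((c₁ ^ 2) ^ ((2 + s - a) / 2) * (w i ^ (a / 2) * w j ^ (a / 2))) := by
      refine mul_le_mul_of_nonneg_left ?_ (by positivity)
      exact (mul_le_mul_of_nonneg_left hMs (by positivity)).trans hpow
    _ = _ := by ring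

theorem mainTheorem1 (k : ℕ) (hk : 2 ≤ k) (ε β : ℝ) (hε : 0 < ε)
    (hβ : (2 * (k : ℝ) - 1) / ((k : ℝ) - 1) + ε ≤ β) (c₁ c₂ : ℝ) (hc₁ : 0 < c₁) :
    ∃ r₀ : ℝ, 0 < r₀ ∧ ∃ δ : ℝ, 0 < δ ∧ ∃ C : ℝ,
      ∀ (n m : ℕ) (w : Fin n → ℝ), k ≤ n → FollowsPowerLaw w β c₁ c₂ → (m : ℝ) / n ≤ r₀ →
        1 - C * (n : ℝ) ^ (-δ) ≤ (randomFormula k m w).real {Φ | Φ.Satisfiable} := by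
  by_cases hc₂ : c₂ < c₁
  · exact ⟨1, one_pos, 1, one_pos, 0, fun n m w _ h => absurd h.const_le (not_le.2 hc₂)⟩
  have hc₂ : 0 < c₂ := hc₁.trans_le (not_lt.1 hc₂)
  have hk' : (2 : ℝ) ≤ k := by exact_mod_cast hk
  have hβk : 2 * (k : ℝ) - 1 < β * (k - 1) := by
    rw [← div_lt_iff₀ (by linarith)]
    linarith
  have hβ2 : 2 < β := by
    by_contra! hle
    nlinarith
  -- The first entry is the exponent that the pair bound requires; it is below `β - 1` exactly when
  -- `2k - 1 < β(k - 1)`. The entry `1` makes `n ^ (-δ)` dominate the largest `p_i` as well.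
  set a := max (2 + (2 - β) * ((k : ℝ) - 2)) 1 with ha
  have ha1 : 1 ≤ a := le_max_right _ _
  have haβ : a < β - 1 := max_lt (by linarith) (by linarith)
  obtain ⟨K, hK, hpair⟩ := exists_lightestPair_bound (c₂ := c₂) hk hc₁ hβ2 (le_max_left _ 1)
  rw [← ha] at hpair
  obtain ⟨D, hD, hsum⟩ := exists_sum_rpow_le (c₂ := c₂) hc₁ (zero_le_one.trans ha1) haβ
  set D' := D * c₁ ^ (a + 1 - β) with hD'
  have hD'0 : 0 ≤ D' := by positivity
  set δ := 1 - a / (β - 1) with hδ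
  have hδ0 : 0 < δ := by
    rw [hδ, sub_pos, div_lt_one (by linarith)]
    exact haβ
  set r₀ := 1 / (8 * (K * D' + 1)) with hr₀
  have hr₀0 : 0 < r₀ := by positivity
  clear_value r₀
  refine ⟨r₀, hr₀0, δ, hδ0, r₀ * K * c₂ ^ a + 2 * k ^ 2 * (c₂ / c₁), fun n m w hkn h hm => ?_⟩
  have hn : 0 < n := by omega
  have hn' : (0 : ℝ) < n := by exact_mod_cast hn
  have hn1 : (1 : ℝ) ≤ n := by exact_mod_cast hn
  have hw : ∀ i, 0 < w i := fun i => hc₁.trans_le (h.le_weight i)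
  have hS : c₁ * n ≤ ∑ i, w i := h.le_sum
  have hS0 : 0 < ∑ i, w i := (mul_pos hc₁ hn').trans_le hS
  rw [div_le_iff₀ hn'] at hm
  have hC0 : 0 ≤ r₀ * K * c₂ ^ a * (n : ℝ) ^ (-δ) := by positivity
  have hC1 : 0 ≤ 2 * k ^ 2 * (c₂ / c₁) * (n : ℝ) ^ (-δ) := by positivity
  -- If this fails, `n` is so small that the second summand of the constant makes the claimed lower
  -- bound negative.
  by_cases hkp : (k : ℝ) ^ 2 * (c₂ / c₁ * (n : ℝ) ^ (-δ)) ≤ 1 / 2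
  swap
  · refine le_trans ?_ measureReal_nonneg
    linarith
  have hp : ∀ i, w i / ∑ j, w j ≤ c₂ / c₁ * (n : ℝ) ^ (-δ) := fun i =>
    calc w i / ∑ j, w j ≤ (c₂ * (n : ℝ) ^ (1 / (β - 1))) / (c₁ * n) := by
          have := h.weight_le i
          gcongr
      _ ≤ (c₂ * (n : ℝ) ^ (a / (β - 1))) / (c₁ * n) := by
          have : 0 < β - 1 := by linarith
          gcongr
      _ = c₂ / c₁ * (n : ℝ) ^ (-δ) := by
          rw [hδ, neg_sub, Real.rpow_sub_one hn'.ne']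
          field_simp
  have hw' := fun i => (hw i).le
  have := isProbabilityMeasure_randomClause hw' hS0 hp hkp
  have hsq : ∀ i, (w i ^ (a / 2)) ^ 2 = w i ^ a := fun i => by
    rw [← Real.rpow_natCast, ← Real.rpow_mul (hw' i)]
    congr 1
    push_cast
    ring
  have hsumq : ∑ i, (w i ^ (a / 2)) ^ 2 ≤ D' * n := by
    have h1 := hsum n w h _ le_rfl
    rw [Finset.filter_true_of_mem fun i _ => ciInf_le (Set.finite_range w).bddBelow i] at h1
    simp only [hsq]
    calc _ ≤ _ := h1
      _ ≤ D * n * c₁ ^ (a + 1 - β) := by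
        gcongr 1
        exact Real.rpow_le_rpow_of_nonpos hc₁ h.min_lower (by linarith)
      _ = _ := by ring
  set R := (c₂ * (n : ℝ) ^ (1 / (β - 1))) ^ a with hR
  have hmax : ∀ i j, w i ^ (a / 2) * w j ^ (a / 2) ≤ R := fun i j => by
    have h1 : ∀ i, w i ^ (a / 2) ≤ (c₂ * (n : ℝ) ^ (1 / (β - 1))) ^ (a / 2) := fun i =>
      Real.rpow_le_rpow (hw' i) (h.weight_le i) (by linarith)
    calc _ ≤ _ := mul_le_mul (h1 i) (h1 j) (by have := hw' j; positivity) (by positivity)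
      _ = R := by rw [← Real.rpow_add (by positivity), add_halves]
  have hκ : 0 ≤ K / (n : ℝ) ^ 2 := by positivity
  have hsmall : (Fintype.card (Fin m) : ℝ) * (K / n ^ 2) * ∑ i, (w i ^ (a / 2)) ^ 2 ≤ 1 / 8 := by
    rw [Fintype.card_fin]
    calc _ ≤ (r₀ * n) * (K / n ^ 2) * (D' * n) := by gcongr
      _ = r₀ * (K * D') := by field_simp
      _ ≤ r₀ * (K * D' + 1) := by gcongr; linarith
      _ = 1 / 8 := by
        rw [hr₀]
        field_simp
  have hbound := measureReal_exists_bicycle_le (ι := Fin m) (randomClause k w)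
    (lightestPair k w) (fun i => w i ^ (a / 2)) hκ (by positivity) hmax
    (fun i j => (randomClause_real_lightestPair_le hw' hS0 hp hkp i j).trans
      (hpair n w hn h i j)) hsmall
  have hunsat : (randomFormula k m w).real {Φ | Φ.Satisfiable}ᶜ ≤
      r₀ * K * c₂ ^ a * (n : ℝ) ^ (-δ) :=
    calc _ ≤ _ := (measureReal_mono (fun Φ hΦ =>
          Formula.exists_bicycle_of_not_satisfiable hk w hΦ) (measure_ne_top _ _)).trans hbound
      -- Here `R` is of order `n ^ (a / (β - 1))`, so the product is of order `n ^ (a / (β - 1) - 1)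
      -- = n ^ (-δ)`.
      _ ≤ (r₀ * n) * (K / n ^ 2) * R := by
        rw [Fintype.card_fin]
        gcongr
      _ = _ := by
        rw [hR, Real.mul_rpow hc₂.le (by positivity), ← Real.rpow_mul hn'.le, hδ, neg_sub,
          Real.rpow_sub_one hn'.ne', one_div_mul_eq_div]
        field_simp
  have : IsProbabilityMeasure (randomFormula k m w) := by
    unfold randomFormula
    infer_instance
  rw [probReal_compl_eq_one_sub (Set.toFinite _).measurableSet] at hunsat
  linarith
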